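/- Fix an integer $M\ge 0$ and $x_0\in\mathbb R$. For a parameter vector $\theta=(\mu_{a,m},\mu_{n,m},\rho_m,\sigma_{a,m},\sigma_{n,m})_{m=1}^M\in\mathbb R^{5M}$ and $x>x_0$ define the Taylor expansion point process estimator (TPE) $$\hat f^{M,\theta}_{TPE}(x)=\sum_{m=1}^M\bigl(\mu_{a,m}+\rho_m\sigma_{a,m}\sigma_{n,m}\ln(x-x_0)\bigr)(x-x_0)^{\mu_{n,m}+\frac{\ln(x-x_0)\,\sigma_{n,m}^2}{2}} .$$ Let the parameter space $\Theta$ be any bounded set of parameter vectors with $\rho_m\in[-1,1]$, $\sigma_{a,m}\ge 0$, $\sigma_{n,m}\ge 0$ for all $m$ and with the ordering $\mu_{a,1}<\mu_{a,2}<\dots<\mu_{a,M}$; let $\theta_M\in\Theta$ be the true parameter and $\sigma^2>0$. Consider the nonlinear regression model $$y_k=\hat f^{M,\theta_M}_{TPE}(x_k)+\epsilon_k,\qquad k=1,2,\dots,$$ where the $x_k$ are i.i.d. with a law on $(x_0,\infty)$ that is not concentrated on finitely many points, the $\epsilon_k$ are i.i.d. $N(0,\sigma^2)$, and the two sequences are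 independent. For almost every outcome and all sufficiently large $K$ let $(\hat\theta_M,\hat\sigma^2)$ (depending on $K$) be a maximum likelihood estimate based on the first $K$ observations, i.e. a maximizer over $\Theta\times(0,\infty)$ of $$L(\theta,s)=(2\pi s)^{-K/2}\exp\Bigl\{-\frac1{2s}\sum_{k=1}^K\bigl(y_k-\hat f^{M,\theta}_{TPE}(x_k)\bigr)^2\Bigr\}.$$ Then, as $K\to\infty$: 1. for every $x>x_0$, $\hat f^{M,\hat\theta_M}_{TPE}(x)\to\hat f^{M,\theta_M}_{TPE}(x)$ almost surely; 2. $\hat\sigma^2\to\sigma^2$ almost surely; 3. the distance from $\hat\theta_M$ to the set of all $\theta\in\overline\Theta$ with $\hat f^{M,\theta}_{TPE}=\hat f^{M,\theta_M}_{TPE}$ on $(x_0,\infty)$ tends to $0$ almost surely; in particular, if $\theta_M$ is the only element of that set, then $\hat\theta_M\to\theta_M$ almost surely. -/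

import Mathlib

open MeasureTheory ProbabilityTheory Filter Topology

/-- The five kinds of parameters of the `m`-th mixture component. -/
inductive TPECoord : Type
  | muA
  | muN
  | rho
  | sigA
  | sigN
  deriving DecidableEq

instance : Fintype TPECoord where
  elems := {.muA, .muN, .rho, .sigA, .sigN}
  complete := by intro c; cases c <;> decide

/-- The parameter vector `θ_M ∈ ℝ^{5M}`: `θ .muA m = μ_{a,m}`, `θ .muN m = μ_{n,m}`,
`θ .rho m = ρ_m`, `θ .sigA m = σ_{a,m}`, `θ .sigN m = σ_{n,m}`, with its usual topology. -/
abbrev TPEParam (M : ℕ) : Type := TPECoord → Fin M → ℝ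

/-- The admissible parameter vectors: correlations, standard deviations, and the ordering
`μ_{a,1} < ... < μ_{a,M}`. -/
def TPEParam.admissible (M : ℕ) : Set (TPEParam M) :=
  {θ | StrictMono (θ .muA) ∧
    ∀ m, θ .rho m ∈ Set.Icc (-1 : ℝ) 1 ∧ 0 ≤ θ .sigA m ∧ 0 ≤ θ .sigN m}

/-- The Taylor expansion Poisson point process estimator (TPE) with parameter `θ`, at `x > x₀`. -/
noncomputable def tpe {M : ℕ} (x₀ : ℝ) (θ : TPEParam M) (x : ℝ) : ℝ :=
  ∑ m, (θ .muA m + θ .rho m * θ .sigA m * θ .sigN m * Real.log (x - x₀)) *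
    (x - x₀) ^ (θ .muN m + Real.log (x - x₀) * θ .sigN m ^ 2 / 2)

/-- The likelihood `L(θ, s | x, y)` of the nonlinear regression model with `N(0, s)` errors, based
on the first `K` observations `(x_k, y_k)`. -/
noncomputable def tpeLikelihood {M : ℕ} (x₀ : ℝ) (K : ℕ) (x y : ℕ → ℝ)
    (θ : TPEParam M) (s : ℝ) : ℝ :=
  (2 * Real.pi * s) ^ (-(K : ℝ) / 2) *
    Real.exp (-(1 / (2 * s)) * ∑ k ∈ Finset.range K, (y k - tpe x₀ θ (x k)) ^ 2)

/-- `(θ, s)` is a maximum likelihood estimate, over the parameter space `Θ × (0, ∞)`, based on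
the first `K` observations. -/
def IsTPEMLE {M : ℕ} (x₀ : ℝ) (Θ : Set (TPEParam M)) (K : ℕ) (x y : ℕ → ℝ)
    (θ : TPEParam M) (s : ℝ) : Prop :=
  θ ∈ Θ ∧ 0 < s ∧
    ∀ θ' ∈ Θ, ∀ s' : ℝ, 0 < s' →
      tpeLikelihood x₀ K x y θ' s' ≤ tpeLikelihood x₀ K x y θ s

/-- The parameters in `closure Θ` that define the same TPE on `(x₀, ∞)` as `θ₀`. -/
def tpeClass {M : ℕ} (x₀ : ℝ) (Θ : Set (TPEParam M)) (θ₀ : TPEParam M) : Set (TPEParam M) :=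
  {θ | θ ∈ closure Θ ∧ ∀ x, x₀ < x → tpe x₀ θ x = tpe x₀ θ₀ x}

/-! This is Wald's consistency argument. A maximizer of the likelihood minimizes the residual sum of
squares, and its variance component is the mean residual square. At the true parameter that mean
tends to `σ ^ 2`; at `θ` its expectation is `σ ^ 2` plus the `P`-mean square of the difference of
the two TPEs, possibly infinite. The excess vanishes only if the TPEs agree `P`-almost surely. In `t
= log (x - x₀)` their difference is a sum of polynomials times exponentials of polynomials, so it
has finitely many zeros or is identically zero; as `P` has no finite carrier, the TPEs then coincide
(`tpe_eq_of_ae_eq`). On the compact part of `closure Θ` at a fixed distance from `tpeClass`,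
`exists_gt_ae_eventually_mul_le_sum` bounds the mean residual squares below by a constant above `σ ^
2`, so a minimizer cannot lie there. Pointwise convergence follows by continuity in `θ`; on all of
`closure Θ` the same bound, with constants just below `σ ^ 2`, gives the variance. -/

/-- Rolle's theorem for zero counts. -/
theorem finite_zeros_of_finite_zeros_deriv {h : ℝ → ℝ} (hd : Differentiable ℝ h)
    (hfin : {t | deriv h t = 0}.Finite) : {t | h t = 0}.Finite := by
  by_contra hinf
  obtain ⟨s, hs, hcard⟩ :=
    Set.Infinite.exists_subset_card_eq hinf (hfin.toFinset.card + 2)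
  -- Interleaving gives at most one more zero of `h` than of its derivative, which `+ 2`
  -- contradicts.
  have := Finset.card_le_of_interleaved (s := s) (t := hfin.toFinset) (by
    intro x hx y hy hxy _
    have hx0 : h x = 0 := hs hx
    have hy0 : h y = 0 := hs hy
    obtain ⟨c, hc, hc0⟩ := exists_deriv_eq_zero hxy hd.continuous.continuousOn (hx0.trans hy0.symm)
    exact ⟨c, by simpa using hc0, hc.1, hc.2⟩)
  omega

/-- An exponential polynomial with polynomial exponents has finitely many real zeros, unless it
vanishes identically. -/
theorem finite_zeros_or_forall_eq_zero {ι : Type*} (s : Finset ι) (p q : ι → Polynomial ℝ) :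
    {t : ℝ | ∑ i ∈ s, (p i).eval t * Real.exp ((q i).eval t) = 0}.Finite ∨
      ∀ t : ℝ, ∑ i ∈ s, (p i).eval t * Real.exp ((q i).eval t) = 0 := by
  classical
  induction s using Finset.induction_on generalizing p q with
  | empty => right; simp
  | insert a s ha ih =>
    -- Inner induction on the number of derivatives that kill `p a`. Dividing by `exp (q a)` and
    -- differentiating lowers this number and keeps the shape of the other terms.
    suffices H : ∀ (d : ℕ) (p q : ι → Polynomial ℝ), Polynomial.derivative^[d] (p a) = 0 →
        {t : ℝ | ∑ i ∈ insert a s, (p i).eval t * Real.exp ((q i).eval t) = 0}.Finite ∨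
          ∀ t : ℝ, ∑ i ∈ insert a s, (p i).eval t * Real.exp ((q i).eval t) = 0 from
      H _ p q (Polynomial.iterate_derivative_eq_zero (Nat.lt_succ_self _))
    intro d
    induction d with
    | zero =>
      intro p q hp
      have hp : p a = 0 := hp
      simpa [Finset.sum_insert ha, hp] using ih p q
    | succ d ihd =>
      intro p q hp
      set h : ℝ → ℝ := fun t =>
        ∑ i ∈ insert a s, (p i).eval t * Real.exp ((q i - q a).eval t) with hh
      have hfh : ∀ t, ∑ i ∈ insert a s, (p i).eval t * Real.exp ((q i).eval t)
          = Real.exp ((q a).eval t) * h t := by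
        intro t
        rw [hh, Finset.mul_sum]
        refine Finset.sum_congr rfl fun i _ => ?_
        rw [mul_left_comm, ← Real.exp_add]
        simp
      have hder : ∀ t, HasDerivAt h (∑ i ∈ insert a s,
          (Polynomial.derivative (p i) + p i * Polynomial.derivative (q i - q a)).eval t *
            Real.exp ((q i - q a).eval t)) t := by
        intro t
        refine (HasDerivAt.fun_sum fun i _ =>
          ((p i).hasDerivAt t).mul (((q i - q a).hasDerivAt t).exp)).congr_deriv ?_
        refine Finset.sum_congr rfl fun i _ => ?_
        simp only [Polynomial.eval_add, Polynomial.eval_mul]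
        ring
      have hdiff : Differentiable ℝ h := fun t => (hder t).differentiableAt
      have hzero : ∀ t, (∑ i ∈ insert a s, (p i).eval t * Real.exp ((q i).eval t) = 0) ↔
          h t = 0 := by
        intro t
        rw [hfh]
        simp [(Real.exp_pos _).ne']
      simp only [hzero]
      rcases ihd (fun i => Polynomial.derivative (p i) + p i * Polynomial.derivative (q i - q a))
        (fun i => q i - q a) (by simpa using hp) with hf | h0
      · left
        refine finite_zeros_of_finite_zeros_deriv hdiff ?_
        simpa only [(hder _).deriv] using hf
      -- If the derivative vanishes identically, `h` is constant: zero everywhere or nowhere.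
      · have hconst := is_const_of_deriv_eq_zero hdiff fun t => (hder t).deriv.trans (h0 t)
        by_cases hz : h 0 = 0
        · right
          exact fun t => (hconst t 0).trans hz
        · left
          convert Set.finite_empty (α := ℝ)
          ext t
          simp [hconst t 0, hz]

/-! ### Reduction of maximum likelihood to least squares -/

/-- The Gaussian profile likelihood: a maximum over the variance is attained only at the mean
residual sum of squares. -/
theorem eq_div_of_forall_gaussian_likelihood_le {n S s : ℝ} (hn : 0 < n) (hS : 0 ≤ S) (hs : 0 < s)
    (hmax : ∀ s' : ℝ, 0 < s' →
      (2 * Real.pi * s') ^ (-n / 2) * Real.exp (-(1 / (2 * s')) * S) ≤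
        (2 * Real.pi * s) ^ (-n / 2) * Real.exp (-(1 / (2 * s)) * S)) :
    s = S / n := by
  have hpi := Real.pi_pos
  have key : ∀ s' : ℝ, 0 < s' →
      -n / 2 * Real.log s' - S / (2 * s') ≤ -n / 2 * Real.log s - S / (2 * s) := by
    intro s' hs'
    have h1 : (0 : ℝ) < 2 * Real.pi * s' := by positivity
    have h2 : (0 : ℝ) < 2 * Real.pi * s := by positivity
    have := Real.log_le_log (by positivity) (hmax s' hs')
    rw [Real.log_mul (by positivity) (by positivity), Real.log_mul (by positivity) (by positivity),
      Real.log_rpow h1, Real.log_rpow h2, Real.log_exp, Real.log_exp,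
      Real.log_mul (by positivity) hs'.ne', Real.log_mul (by positivity) hs.ne'] at this
    have e1 : -(1 / (2 * s')) * S = -(S / (2 * s')) := by ring
    have e2 : -(1 / (2 * s)) * S = -(S / (2 * s)) := by ring
    rw [e1, e2] at this
    linarith
  rcases hS.eq_or_lt with rfl | hS
  -- With `S = 0` the likelihood is a multiple of `s ^ (-n / 2)`; halving `s` increases it, so no
  -- maximum exists.
  · have := key (s / 2) (by positivity)
    rw [Real.log_div hs.ne' two_ne_zero] at this
    have := mul_pos hn (Real.log_pos one_lt_two)
    simp at *
    nlinarith
  · by_contra hne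
    have := key (S / n) (by positivity)
    -- The comparison with `s' = S / n` contradicts `log u < u - 1` at `u = S / (n * s) ≠ 1`.
    have hu : S / (n * s) ≠ 1 := by
      intro h
      rw [div_eq_one_iff_eq (by positivity)] at h
      exact hne (by rw [h]; field_simp)
    have hlog := Real.log_lt_sub_one_of_pos (by positivity) hu
    have e1 : S / (2 * (S / n)) = n / 2 := by field_simp
    have e2 : S / (2 * s) = n / 2 * (S / (n * s)) := by field_simp
    rw [Real.log_div hS.ne' (by positivity), Real.log_mul hn.ne' hs.ne'] at hlog
    rw [Real.log_div hS.ne' hn.ne', e1, e2] at this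
    nlinarith

/-- At equal variance `s` the prefactors cancel, and the likelihood decreases in the sum of squares.
-/
theorem IsTPEMLE.sum_sq_le {M : ℕ} {x₀ : ℝ} {Θ : Set (TPEParam M)} {K : ℕ} {x y : ℕ → ℝ}
    {θ : TPEParam M} {s : ℝ} (h : IsTPEMLE x₀ Θ K x y θ s) {θ' : TPEParam M} (hθ' : θ' ∈ Θ) :
    ∑ k ∈ Finset.range K, (y k - tpe x₀ θ (x k)) ^ 2 ≤
      ∑ k ∈ Finset.range K, (y k - tpe x₀ θ' (x k)) ^ 2 := by
  obtain ⟨-, hs, hmax⟩ := h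
  have hpi := Real.pi_pos
  have h1 := hmax θ' hθ' s hs
  unfold tpeLikelihood at h1
  rw [mul_le_mul_iff_right₀ (by positivity), Real.exp_le_exp] at h1
  have : 0 < 1 / (2 * s) := by positivity
  nlinarith

theorem IsTPEMLE.variance_eq {M : ℕ} {x₀ : ℝ} {Θ : Set (TPEParam M)} {K : ℕ} (hK : 0 < K)
    {x y : ℕ → ℝ} {θ : TPEParam M} {s : ℝ} (h : IsTPEMLE x₀ Θ K x y θ s) :
    s = (∑ k ∈ Finset.range K, (y k - tpe x₀ θ (x k)) ^ 2) / K :=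
  eq_div_of_forall_gaussian_likelihood_le (by exact_mod_cast hK)
    (Finset.sum_nonneg fun _ _ => sq_nonneg _) h.2.1 fun s' hs' => h.2.2 θ h.1 s' hs'

/-! ### The TPE in the logarithmic variable -/

/-- The TPE as a function of `t = log (x - x₀)`. -/
noncomputable def tpeLog {M : ℕ} (θ : TPEParam M) (t : ℝ) : ℝ :=
  ∑ m, (θ .muA m + θ .rho m * θ .sigA m * θ .sigN m * t) *
    Real.exp (t * (θ .muN m + t * θ .sigN m ^ 2 / 2))

theorem tpe_eq_tpeLog {M : ℕ} {x₀ x : ℝ} (hx : x₀ < x) (θ : TPEParam M) :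
    tpe x₀ θ x = tpeLog θ (Real.log (x - x₀)) := by
  unfold tpe tpeLog
  refine Finset.sum_congr rfl fun m _ => ?_
  rw [Real.rpow_def_of_pos (sub_pos.2 hx)]

theorem continuous_tpeLog_param {M : ℕ} (t : ℝ) : Continuous fun θ : TPEParam M => tpeLog θ t := by
  unfold tpeLog
  fun_prop

theorem continuous_tpeLog {M : ℕ} (θ : TPEParam M) : Continuous (tpeLog θ) := by
  unfold tpeLog
  fun_prop

theorem continuous_tpe_param {M : ℕ} {x₀ x : ℝ} (hx : x₀ < x) :
    Continuous fun θ : TPEParam M => tpe x₀ θ x := by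
  simpa only [tpe_eq_tpeLog hx] using continuous_tpeLog_param _

theorem finite_tpeLog_eq_or_forall {M : ℕ} (θ θ' : TPEParam M) :
    {t | tpeLog θ t = tpeLog θ' t}.Finite ∨ ∀ t, tpeLog θ t = tpeLog θ' t := by
  let p : Fin M ⊕ Fin M → Polynomial ℝ := Sum.elim
    (fun m => .C (θ .muA m) + .C (θ .rho m * θ .sigA m * θ .sigN m) * .X)
    (fun m => -(.C (θ' .muA m) + .C (θ' .rho m * θ' .sigA m * θ' .sigN m) * .X))
  let q : Fin M ⊕ Fin M → Polynomial ℝ := Sum.elim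
    (fun m => .X * (.C (θ .muN m) + .X * .C (θ .sigN m ^ 2 / 2)))
    (fun m => .X * (.C (θ' .muN m) + .X * .C (θ' .sigN m ^ 2 / 2)))
  have e : ∀ t, (tpeLog θ t = tpeLog θ' t) ↔
      ∑ i, (p i).eval t * Real.exp ((q i).eval t) = 0 := by
    intro t
    rw [← sub_eq_zero]
    simp only [p, q, tpeLog, Fintype.sum_sum_type, sub_eq_add_neg, ← Finset.sum_neg_distrib,
      Sum.elim_inl, Sum.elim_inr, Polynomial.eval_add, Polynomial.eval_mul, Polynomial.eval_neg,
      Polynomial.eval_C, Polynomial.eval_X, neg_mul, mul_div_assoc]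
  simp only [e]
  exact finite_zeros_or_forall_eq_zero _ p q

/-! ### Wald's lower bound from the strong law -/

section Wald

variable {Ω Z E : Type*} [MeasurableSpace Ω] {μ : Measure Ω} [MeasurableSpace Z]
  {W : ℕ → Ω → Z} {ν : Measure Z}

theorem ae_eventually_mul_le_sum (hindep : iIndepFun W μ) (hlaw : ∀ k, HasLaw (W k) ν μ)
    {g : Z → ℝ} (hg : Measurable g) (hint : Integrable g ν) {c : ℝ} (hc : c < ∫ z, g z ∂ν) :
    ∀ᵐ ω ∂μ, ∀ᶠ K : ℕ in atTop, c * K ≤ ∑ k ∈ Finset.range K, g (W k ω) := by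
  have hlln := strong_law_ae_real (μ := μ) (fun k => g ∘ W k)
    (Integrable.comp_aemeasurable (by rwa [(hlaw 0).map_eq]) (hlaw 0).aemeasurable)
    (fun i j hij => (hindep.indepFun hij).comp hg hg)
    (fun i => ((hlaw i).identDistrib (hlaw 0)).comp hg)
  have hI : ∫ ω, (g ∘ W 0) ω ∂μ = ∫ z, g z ∂ν := (hlaw 0).integral_comp hg.aestronglyMeasurable
  rw [hI] at hlln
  filter_upwards [hlln] with ω hω
  filter_upwards [hω.eventually_const_lt hc, eventually_gt_atTop 0] with K hK hK0
  have : (0 : ℝ) < K := by exact_mod_cast hK0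
  exact ((lt_div_iff₀ this).1 hK).le

variable [IsProbabilityMeasure ν] [PseudoMetricSpace E] [SecondCountableTopology E]

/-- By continuity, infima over shrinking balls increase to `φ θ₁`. Monotone convergence then pushes
their integrals above `c`, even if `φ θ₁` is not integrable. -/
theorem exists_measurable_lower_bound_ball [Nonempty E] {φ : E → Z → ℝ}
    (hm : ∀ θ, Measurable (φ θ))
    (h0 : ∀ θ z, 0 ≤ φ θ z) (hc : ∀ z, Continuous fun θ => φ θ z) (θ₁ : E) {c : ℝ}
    (h : ENNReal.ofReal c < ∫⁻ z, ENNReal.ofReal (φ θ₁ z) ∂ν) :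
    ∃ r > 0, ∃ g : Z → ℝ, Measurable g ∧ Integrable g ν ∧ c < ∫ z, g z ∂ν ∧
      ∀ θ ∈ Metric.ball θ₁ r, ∀ z, g z ≤ φ θ z := by
  classical
  let r : ℕ → ℝ := fun n => 1 / ((n : ℝ) + 1)
  have hr : ∀ n, 0 < r n := fun n => Nat.one_div_pos_of_nat
  have hranti : Antitone r := fun m n hmn => Nat.one_div_le_one_div hmn
  let D := TopologicalSpace.denseSeq E
  -- A countable dense set keeps the infimum measurable and, by continuity, loses nothing on the
  -- open ball; `⊤` discards points outside it.
  let A : ℕ → Z → ENNReal := fun n z =>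
    ⨅ i, if D i ∈ Metric.ball θ₁ (r n) then ENNReal.ofReal (φ (D i) z) else ⊤
  -- Truncation at `n` makes the minorant integrable and preserves monotonicity in `n`.
  let ψ : ℕ → Z → ENNReal := fun n z => min (A n z) n
  have hAle : ∀ n z, ∀ θ ∈ Metric.ball θ₁ (r n), A n z ≤ ENNReal.ofReal (φ θ z) := by
    intro n z θ hθ
    have hcl : θ ∈ closure (Metric.ball θ₁ (r n) ∩ Set.range D) :=
      (TopologicalSpace.denseRange_denseSeq E).open_subset_closure_inter Metric.isOpen_ball hθ
    have hclosed : IsClosed {θ | A n z ≤ ENNReal.ofReal (φ θ z)} :=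
      isClosed_le continuous_const (ENNReal.continuous_ofReal.comp (hc z))
    refine closure_minimal ?_ hclosed hcl
    rintro _ ⟨hb, i, rfl⟩
    exact (iInf_le (fun i => if D i ∈ Metric.ball θ₁ (r n) then ENNReal.ofReal (φ (D i) z) else ⊤)
      i).trans (if_pos hb).le
  have hψm : ∀ n, Measurable (ψ n) := by
    intro n
    refine (Measurable.iInf fun i => ?_).min measurable_const
    split_ifs
    · exact (hm _).ennreal_ofReal
    · exact measurable_const
  have hψmono : ∀ z, Monotone fun n => ψ n z := by
    intro z m n hmn
    refine min_le_min (iInf_mono fun i => ?_) (by exact_mod_cast hmn)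
    by_cases hi : D i ∈ Metric.ball θ₁ (r n)
    · rw [if_pos hi, if_pos (Metric.ball_subset_ball (hranti hmn) hi)]
    · rw [if_neg hi]; exact le_top
  have hψlim : ∀ z, Tendsto (fun n => ψ n z) atTop (𝓝 (ENNReal.ofReal (φ θ₁ z))) := by
    intro z
    refine tendsto_order.2 ⟨fun a ha => ?_, fun a ha => Eventually.of_forall fun n => ?_⟩
    · obtain ⟨b, hab, hb⟩ := exists_between ha
      have hcont : Continuous fun θ => ENNReal.ofReal (φ θ z) :=
        ENNReal.continuous_ofReal.comp (hc z)
      obtain ⟨δ, hδ, hball⟩ := Metric.eventually_nhds_iff_ball.1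
        (hcont.continuousAt.eventually_const_lt hb)
      have hr0 : Tendsto r atTop (𝓝 0) := tendsto_one_div_add_atTop_nhds_zero_nat
      have hn1 : ∀ᶠ n : ℕ in atTop, a < (n : ENNReal) :=
        ENNReal.tendsto_nat_nhds_top.eventually_const_lt (hab.trans_le le_top)
      filter_upwards [hr0.eventually_lt_const hδ, hn1] with n hn hn1
      refine lt_min (hab.trans_le (le_iInf fun i => ?_)) hn1
      split_ifs with hi
      · exact (hball _ (Metric.ball_subset_ball hn.le hi)).le
      · exact le_top
    · exact ((min_le_left _ _).trans (hAle n z θ₁ (Metric.mem_ball_self (hr n)))).trans_lt ha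
  have hlim := lintegral_tendsto_of_tendsto_of_monotone (μ := ν) (fun n => (hψm n).aemeasurable)
    (ae_of_all _ hψmono) (ae_of_all _ hψlim)
  obtain ⟨n, hn⟩ := (hlim.eventually_const_lt h).exists
  have hle : ∀ z, ψ n z ≤ n := fun z => min_le_right _ _
  have htop : ∀ z, ψ n z ≠ ⊤ := fun z => ((hle z).trans_lt (ENNReal.natCast_lt_top n)).ne
  have hint : Integrable (fun z => (ψ n z).toReal) ν := by
    refine Integrable.of_bound (hψm n).ennreal_toReal.aestronglyMeasurable n (ae_of_all _ fun z => ?_)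
    rw [Real.norm_of_nonneg ENNReal.toReal_nonneg]
    exact ENNReal.toReal_le_of_le_ofReal (Nat.cast_nonneg n) (by simpa using hle z)
  refine ⟨r n, hr n, fun z => (ψ n z).toReal, (hψm n).ennreal_toReal, hint, ?_, fun θ hθ z => ?_⟩
  · have := ofReal_integral_eq_lintegral_ofReal hint (ae_of_all _ fun z => ENNReal.toReal_nonneg)
    simp only [ENNReal.ofReal_toReal (htop _)] at this
    rw [← this] at hn
    exact (ENNReal.ofReal_lt_ofReal_iff'.1 hn).1
  · exact ENNReal.toReal_le_of_le_ofReal (h0 θ z)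
      ((min_le_left _ _).trans (hAle n z θ hθ))

/-- Wald's uniform lower bound over a compact parameter set, without any moment condition. -/
theorem exists_gt_ae_eventually_mul_le_sum (hindep : iIndepFun W μ)
    (hlaw : ∀ k, HasLaw (W k) ν μ) {φ : E → Z → ℝ} (hm : ∀ θ, Measurable (φ θ))
    (h0 : ∀ θ z, 0 ≤ φ θ z) (hc : ∀ z, Continuous fun θ => φ θ z) {C : Set E} (hC : IsCompact C)
    {c : ℝ} (h : ∀ θ ∈ C, ENNReal.ofReal c < ∫⁻ z, ENNReal.ofReal (φ θ z) ∂ν) :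
    ∃ c' > c, ∀ᵐ ω ∂μ, ∀ᶠ K : ℕ in atTop, ∀ θ ∈ C,
      c' * K ≤ ∑ k ∈ Finset.range K, φ θ (W k ω) := by
  refine hC.induction_on (p := fun s => ∃ c' > c, ∀ᵐ ω ∂μ, ∀ᶠ K : ℕ in atTop, ∀ θ ∈ s,
      c' * K ≤ ∑ k ∈ Finset.range K, φ θ (W k ω)) ⟨c + 1, by simp, by simp⟩ ?_ ?_ ?_
  · rintro s t hst ⟨c', hc', H⟩
    refine ⟨c', hc', ?_⟩
    filter_upwards [H] with ω hω
    filter_upwards [hω] with K hK θ hθ using hK θ (hst hθ)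
  · rintro s t ⟨c₁, hc₁, H₁⟩ ⟨c₂, hc₂, H₂⟩
    refine ⟨min c₁ c₂, lt_min hc₁ hc₂, ?_⟩
    filter_upwards [H₁, H₂] with ω h₁ h₂
    filter_upwards [h₁, h₂] with K hK₁ hK₂
    rintro θ (hθ | hθ)
    · exact (mul_le_mul_of_nonneg_right (min_le_left _ _) K.cast_nonneg).trans (hK₁ θ hθ)
    · exact (mul_le_mul_of_nonneg_right (min_le_right _ _) K.cast_nonneg).trans (hK₂ θ hθ)
  · intro θ₁ hθ₁
    have : Nonempty E := ⟨θ₁⟩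
    obtain ⟨r, hr, g, hg, hgi, hcg, hle⟩ :=
      exists_measurable_lower_bound_ball hm h0 hc θ₁ (h θ₁ hθ₁)
    obtain ⟨c', hc', hc'g⟩ := exists_between hcg
    refine ⟨Metric.ball θ₁ r, mem_nhdsWithin_of_mem_nhds (Metric.ball_mem_nhds _ hr), c', hc', ?_⟩
    filter_upwards [ae_eventually_mul_le_sum hindep hlaw hg hgi hc'g] with ω hω
    filter_upwards [hω] with K hK θ hθ
    exact hK.trans (Finset.sum_le_sum fun k _ => hle θ hθ _)

end Wald

/-! ### Gaussian second moments and the expected squared residual -/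

theorem integrable_sq_gaussianReal_zero (v : NNReal) :
    Integrable (fun e : ℝ => e ^ 2) (gaussianReal 0 v) :=
  (memLp_id_gaussianReal (μ := 0) (v := v) 2).integrable_sq

theorem integral_sq_gaussianReal_zero (v : NNReal) : ∫ e, e ^ 2 ∂gaussianReal 0 v = v := by
  have := variance_eq_sub (memLp_id_gaussianReal (μ := 0) (v := v) 2)
  simpa [variance_id_gaussianReal, integral_id_gaussianReal] using this.symm

theorem lintegral_sub_sq_gaussianReal_zero (v : NNReal) (a : ℝ) :
    ∫⁻ e, ENNReal.ofReal ((e - a) ^ 2) ∂gaussianReal 0 v = v + ENNReal.ofReal (a ^ 2) := by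
  have h1 := integrable_sq_gaussianReal_zero v
  have h2 : Integrable (fun e : ℝ => e) (gaussianReal 0 v) :=
    (memLp_id_gaussianReal (μ := 0) (v := v) 1).integrable (by simp)
  have h3 := h1.sub (h2.const_mul (2 * a))
  have e : (fun e : ℝ => (e - a) ^ 2) =
      ((fun e => e ^ 2) - fun e => 2 * a * e) + fun _ => a ^ 2 := by
    ext; simp only [Pi.add_apply, Pi.sub_apply]; ring
  have hint : Integrable (fun e : ℝ => (e - a) ^ 2) (gaussianReal 0 v) := by
    rw [e]; exact h3.add (integrable_const _)
  rw [← ofReal_integral_eq_lintegral_ofReal hint (ae_of_all _ fun _ => sq_nonneg _), e,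
    integral_add' h3 (integrable_const _), integral_sub' h1 (h2.const_mul _), integral_const_mul,
    integral_sq_gaussianReal_zero, integral_id_gaussianReal]
  simp [ENNReal.ofReal_add, sq_nonneg]

theorem lintegral_prod_gaussianReal_sub_sq {α : Type*} [MeasurableSpace α] (P : Measure α)
    [IsProbabilityMeasure P] (v : NNReal) {g : α → ℝ} (hg : Measurable g) :
    ∫⁻ z, ENNReal.ofReal ((z.2 - g z.1) ^ 2) ∂P.prod (gaussianReal 0 v) =
      v + ∫⁻ x, ENNReal.ofReal (g x ^ 2) ∂P := by
  rw [lintegral_prod _ (by fun_prop)]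
  simp only [lintegral_sub_sq_gaussianReal_zero]
  rw [lintegral_add_left measurable_const]
  simp

theorem hasLaw_prodMk_of_indepFun {Ω α β : Type*} [MeasurableSpace Ω] [MeasurableSpace α]
    [MeasurableSpace β] {μ : Measure Ω} [IsFiniteMeasure μ] {X : Ω → α} {Y : Ω → β}
    {P : Measure α} {Q : Measure β} (hX : HasLaw X P μ) (hY : HasLaw Y Q μ)
    (h : IndepFun X Y μ) : HasLaw (fun ω => (X ω, Y ω)) (P.prod Q) μ where
  aemeasurable := hX.aemeasurable.prodMk hY.aemeasurable
  map_eq := by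
    rw [(indepFun_iff_map_prod_eq_prod_map_map hX.aemeasurable hY.aemeasurable).1 h,
      hX.map_eq, hY.map_eq]

/-! ### Identification of the TPE and consistency -/

/-- A TPE that agrees with another one almost surely under a law on `(x₀, ∞)` without finite
carrier agrees with it on all of `(x₀, ∞)`. -/
theorem tpe_eq_of_ae_eq {M : ℕ} {x₀ : ℝ} {P : Measure ℝ} [IsProbabilityMeasure P]
    (hP : ∀ᵐ x ∂P, x₀ < x) (hPfin : ∀ F : Set ℝ, F.Finite → P F < 1) {θ θ' : TPEParam M}
    (h : ∀ᵐ x ∂P, tpeLog θ (Real.log (x - x₀)) = tpeLog θ' (Real.log (x - x₀)))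
    {x : ℝ} (hx : x₀ < x) : tpe x₀ θ x = tpe x₀ θ' x := by
  rw [tpe_eq_tpeLog hx, tpe_eq_tpeLog hx]
  rcases finite_tpeLog_eq_or_forall θ θ' with hfin | hall
  · exfalso
    -- The agreement points in `t`, carried back by `t ↦ x₀ + exp t`, would be a finite set of full
    -- measure.
    refine (hPfin _ (hfin.image fun t => x₀ + Real.exp t)).ne ?_
    rw [prob_compl_eq_zero_iff₀ ((hfin.image _).measurableSet.nullMeasurableSet) |>.symm]
    refine mem_ae_iff.1 ?_
    filter_upwards [h, hP] with x h1 h2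
    exact ⟨_, h1, by simp [Real.exp_log (sub_pos.2 h2)]⟩
  · exact hall _

theorem theorem2 {Ω : Type*} [MeasurableSpace Ω] (μ : Measure Ω) [IsProbabilityMeasure μ]
    (M : ℕ) (x₀ : ℝ) (Θ : Set (TPEParam M)) (hΘ : Θ ⊆ TPEParam.admissible M)
    (hΘb : Bornology.IsBounded Θ) (θ₀ : TPEParam M) (hθ₀ : θ₀ ∈ Θ) (σ : ℝ) (hσ : 0 < σ)
    -- the design points: i.i.d. with a law on `(x₀, ∞)` that is not carried by a finite set
    (P : Measure ℝ) [IsProbabilityMeasure P] (hP : ∀ᵐ x ∂P, x₀ < x)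
    (hPfin : ∀ F : Set ℝ, F.Finite → P F < 1)
    (X ε Y : ℕ → Ω → ℝ) (hX : ∀ k, HasLaw (X k) P μ)
    -- the errors: i.i.d. centred Gaussian, independent of the design
    (hε : ∀ k, HasLaw (ε k) (gaussianReal 0 (Real.toNNReal (σ ^ 2))) μ)
    (hXε : ∀ k, IndepFun (X k) (ε k) μ)
    (hindep : iIndepFun (fun k ω => (X k ω, ε k ω)) μ)
    -- the nonlinear regression model with true parameters `θ₀` and `σ ^ 2`
    (hY : ∀ k ω, Y k ω = tpe x₀ θ₀ (X k ω) + ε k ω)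
    -- the maximum likelihood estimators
    (θhat : ℕ → Ω → TPEParam M) (s2hat : ℕ → Ω → ℝ)
    (hMLE : ∀ᵐ ω ∂μ, ∀ᶠ K in atTop,
      IsTPEMLE x₀ Θ K (fun k => X k ω) (fun k => Y k ω) (θhat K ω) (s2hat K ω)) :
    (∀ x, x₀ < x →
      ∀ᵐ ω ∂μ, Tendsto (fun K => tpe x₀ (θhat K ω) x) atTop (𝓝 (tpe x₀ θ₀ x))) ∧
    (∀ᵐ ω ∂μ, Tendsto (fun K => s2hat K ω) atTop (𝓝 (σ ^ 2))) ∧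
    (∀ᵐ ω ∂μ, Tendsto (fun K => Metric.infDist (θhat K ω) (tpeClass x₀ Θ θ₀)) atTop (𝓝 0)) ∧
    (tpeClass x₀ Θ θ₀ = {θ₀} →
      ∀ᵐ ω ∂μ, Tendsto (fun K => θhat K ω) atTop (𝓝 θ₀)) := by
  set v : NNReal := Real.toNNReal (σ ^ 2)
  let g : TPEParam M → ℝ → ℝ := fun θ x =>
    tpeLog θ (Real.log (x - x₀)) - tpeLog θ₀ (Real.log (x - x₀))
  -- The squared residual in terms of design point and error: `Y - tpe θ = ε - g θ`.
  let φ : TPEParam M → ℝ × ℝ → ℝ := fun θ z => (z.2 - g θ z.1) ^ 2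
  let SS : ℕ → Ω → TPEParam M → ℝ := fun K ω θ =>
    ∑ k ∈ Finset.range K, (Y k ω - tpe x₀ θ (X k ω)) ^ 2
  have hgm : ∀ θ, Measurable (g θ) := fun θ =>
    ((continuous_tpeLog θ).measurable.comp (by fun_prop)).sub
      ((continuous_tpeLog θ₀).measurable.comp (by fun_prop))
  have hφm : ∀ θ, Measurable (φ θ) := fun θ =>
    (measurable_snd.sub ((hgm θ).comp measurable_fst)).pow_const 2
  have hφc : ∀ z, Continuous fun θ => φ θ z := fun z =>
    (continuous_const.sub ((continuous_tpeLog_param _).sub continuous_const)).pow 2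
  have hφ0 : ∀ θ z, 0 ≤ φ θ z := fun θ z => sq_nonneg _
  have hlaw : ∀ k, HasLaw (fun ω => (X k ω, ε k ω)) (P.prod (gaussianReal 0 v)) μ :=
    fun k => hasLaw_prodMk_of_indepFun (hX k) (hε k) (hXε k)
  have hE : ∀ θ, ∫⁻ z, ENNReal.ofReal (φ θ z) ∂P.prod (gaussianReal 0 v) =
      ENNReal.ofReal (σ ^ 2) + ∫⁻ x, ENNReal.ofReal (g θ x ^ 2) ∂P := fun θ =>
    lintegral_prod_gaussianReal_sub_sq P v (hgm θ)
  have hSS : ∀ᵐ ω ∂μ, ∀ K θ, SS K ω θ = ∑ k ∈ Finset.range K, φ θ (X k ω, ε k ω) := by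
    have hXpos : ∀ᵐ ω ∂μ, ∀ k, x₀ < X k ω := ae_all_iff.2 fun k =>
      ae_of_ae_map (hX k).aemeasurable (by rwa [(hX k).map_eq])
    filter_upwards [hXpos] with ω hω K θ
    refine Finset.sum_congr rfl fun k _ => ?_
    simp only [φ, g, hY, tpe_eq_tpeLog (hω k)]
    ring
  have hnoise : ∀ᵐ ω ∂μ, Tendsto (fun K : ℕ => SS K ω θ₀ / K) atTop (𝓝 (σ ^ 2)) := by
    have hm : Measurable fun z : ℝ × ℝ => z.2 ^ 2 := by fun_prop
    have hm' : Measurable fun e : ℝ => e ^ 2 := by fun_prop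
    have hlln := strong_law_ae_real (μ := μ) (fun k ω => ε k ω ^ 2)
      (Integrable.comp_aemeasurable (g := fun e : ℝ => e ^ 2)
        (by rw [(hε 0).map_eq]; exact integrable_sq_gaussianReal_zero v) (hε 0).aemeasurable)
      (fun i j hij => (hindep.indepFun hij).comp hm hm)
      (fun i => ((hε i).identDistrib (hε 0)).comp hm')
    have hI : ∫ ω, ε 0 ω ^ 2 ∂μ = σ ^ 2 := by
      refine ((hε 0).integral_comp (f := fun e : ℝ => e ^ 2) hm'.aestronglyMeasurable).trans ?_
      rw [integral_sq_gaussianReal_zero, Real.coe_toNNReal _ (sq_nonneg σ)]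
    rw [hI] at hlln
    filter_upwards [hlln] with ω hω
    simpa [SS, hY] using hω
  have hcpt : IsCompact (closure Θ) := hΘb.isCompact_closure
  have hclosed : IsClosed (tpeClass x₀ Θ θ₀) := by
    have : tpeClass x₀ Θ θ₀ =
        closure Θ ∩ ⋂ x, ⋂ (_ : x₀ < x), {θ | tpe x₀ θ x = tpe x₀ θ₀ x} := by
      ext; simp [tpeClass]
    rw [this]
    exact isClosed_closure.inter (isClosed_iInter fun x => isClosed_iInter fun hx =>
      isClosed_eq (continuous_tpe_param hx) continuous_const)
  have hTcpt : IsCompact (tpeClass x₀ Θ θ₀) := hcpt.of_isClosed_subset hclosed fun _ h => h.1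
  have hTne : (tpeClass x₀ Θ θ₀).Nonempty := ⟨θ₀, subset_closure hθ₀, fun _ _ => rfl⟩
  have hpos : ∀ n : ℕ, (0 : ℝ) < 1 / ((n : ℝ) + 1) := fun n => Nat.one_div_pos_of_nat
  have hdist : ∀ᵐ ω ∂μ,
      Tendsto (fun K => Metric.infDist (θhat K ω) (tpeClass x₀ Θ θ₀)) atTop (𝓝 0) := by
    have hfar : ∀ n : ℕ, ∃ c' > σ ^ 2, ∀ᵐ ω ∂μ, ∀ᶠ K : ℕ in atTop,
        ∀ θ ∈ closure Θ ∩ {θ | 1 / ((n : ℝ) + 1) ≤ Metric.infDist θ (tpeClass x₀ Θ θ₀)},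
          c' * K ≤ ∑ k ∈ Finset.range K, φ θ (X k ω, ε k ω) := by
      intro n
      refine exists_gt_ae_eventually_mul_le_sum hindep hlaw hφm hφ0 hφc
        (hcpt.inter_right (isClosed_le continuous_const (Metric.continuous_infDist_pt _))) ?_
      rintro θ ⟨hθ, hθd⟩
      rw [hE]
      -- A zero excess would put `θ` in the class, at distance `0` from it.
      refine ENNReal.lt_add_right ENNReal.ofReal_ne_top fun h0 => ?_
      rw [lintegral_eq_zero_iff ((hgm θ).pow_const 2).ennreal_ofReal] at h0
      have hmem : θ ∈ tpeClass x₀ Θ θ₀ := by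
        refine ⟨hθ, fun x hx => tpe_eq_of_ae_eq hP hPfin ?_ hx⟩
        filter_upwards [h0] with x hx0
        have hsq : g θ x ^ 2 ≤ 0 := ENNReal.ofReal_eq_zero.1 hx0
        exact sub_eq_zero.1 (pow_eq_zero_iff two_ne_zero |>.1 (le_antisymm hsq (sq_nonneg _)))
      have hθd : 1 / ((n : ℝ) + 1) ≤ Metric.infDist θ (tpeClass x₀ Θ θ₀) := hθd
      rw [Metric.infDist_zero_of_mem hmem] at hθd
      exact (hpos n).not_ge hθd
    choose c' hc' hfar using hfar
    filter_upwards [ae_all_iff.2 hfar, hSS, hnoise, hMLE] with ω hfarω hSSω hnoiseω hMLEω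
    refine tendsto_order.2 ⟨fun a ha => Eventually.of_forall fun K =>
      ha.trans_le Metric.infDist_nonneg, fun a ha => ?_⟩
    obtain ⟨n, hn⟩ := exists_nat_one_div_lt ha
    filter_upwards [hfarω n, hnoiseω.eventually_lt_const (hc' n), hMLEω, eventually_gt_atTop 0]
      with K hK hKn hKM hK0
    by_contra hcon
    have hle := hK (θhat K ω) ⟨subset_closure hKM.1, hn.le.trans (not_lt.1 hcon)⟩
    rw [← hSSω, ← le_div_iff₀ (by exact_mod_cast hK0)] at hle
    have hmin : SS K ω (θhat K ω) ≤ SS K ω θ₀ := hKM.sum_sq_le hθ₀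
    exact absurd (hle.trans (div_le_div_of_nonneg_right hmin K.cast_nonneg)) (not_le.2 hKn)
  refine ⟨fun x hx => ?_, ?_, hdist, fun hT => ?_⟩
  · filter_upwards [hdist] with ω hω
    refine tendsto_nhds.2 fun U hU hxU => ?_
    -- The estimate need not converge, but the compact class has a uniform neighbourhood on which
    -- the value at `x` stays in `U`.
    obtain ⟨δ, hδ, hsub⟩ := hTcpt.exists_thickening_subset_open
      (hU.preimage (continuous_tpe_param hx)) fun θ hθ => by
        simpa only [Set.mem_preimage, hθ.2 x hx] using hxU
    filter_upwards [hω.eventually_lt_const hδ] with K hK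
    exact hsub ((Metric.mem_thickening_iff_infDist_lt hTne).2 hK)
  -- On the class the expected squared residual is exactly `σ ^ 2`, so a strict bound needs the
  -- slack `1 / (n + 1)`.
  · have hlow : ∀ n : ℕ, ∃ c' > σ ^ 2 - 1 / ((n : ℝ) + 1), ∀ᵐ ω ∂μ, ∀ᶠ K : ℕ in atTop,
        ∀ θ ∈ closure Θ, c' * K ≤ ∑ k ∈ Finset.range K, φ θ (X k ω, ε k ω) := by
      intro n
      refine exists_gt_ae_eventually_mul_le_sum hindep hlaw hφm hφ0 hφc hcpt fun θ _ => ?_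
      rw [hE]
      refine lt_of_lt_of_le ?_ le_self_add
      exact (ENNReal.ofReal_lt_ofReal_iff (by positivity)).2 (sub_lt_self _ (hpos n))
    choose c' hc' hlow using hlow
    filter_upwards [ae_all_iff.2 hlow, hSS, hnoise, hMLE] with ω hlowω hSSω hnoiseω hMLEω
    have hs2 : ∀ᶠ K : ℕ in atTop, s2hat K ω = SS K ω (θhat K ω) / K := by
      filter_upwards [hMLEω, eventually_gt_atTop 0] with K hK hK0 using hK.variance_eq hK0
    refine tendsto_order.2 ⟨fun a ha => ?_, fun a ha => ?_⟩
    · obtain ⟨n, hn⟩ := exists_nat_one_div_lt (sub_pos.2 ha)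
      filter_upwards [hlowω n, hMLEω, hs2, eventually_gt_atTop 0] with K hK hKM hKs hK0
      have hle := hK (θhat K ω) (subset_closure hKM.1)
      rw [← hSSω, ← le_div_iff₀ (by exact_mod_cast hK0), ← hKs] at hle
      linarith [hc' n]
    · filter_upwards [hnoiseω.eventually_lt_const ha, hMLEω, hs2] with K hK hKM hKs
      rw [hKs]
      have hmin : SS K ω (θhat K ω) ≤ SS K ω θ₀ := hKM.sum_sq_le hθ₀
      exact (div_le_div_of_nonneg_right hmin K.cast_nonneg).trans_lt hK
  · filter_upwards [hdist] with ω hω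
    rw [tendsto_iff_dist_tendsto_zero]
    simpa only [hT, Metric.infDist_singleton] using hω
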